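/- Write $\log x:=\max\{\ln x,2\}$ and $\log_2 x:=\log(\log x)$. A finite set $\{n_1,\dots,n_k\}$ of positive integers is called multiplicatively independent if $\alpha_1=\dots=\alpha_k=0$ is the only integer solution of $n_1^{\alpha_1}\cdots n_k^{\alpha_k}=1$; for a finite set $\mathscr N$ of positive integers let $I_k(\mathscr N)$ be the number of multiplicatively independent subsets of $\mathscr N$ with exactly $k$ elements. For every integer $q\ge 1$ there is a set $\mathscr N_q\subseteq\{2,3,\dots,q-1\}$ such that, as $q\to\infty$, the following hold. (1) $\#\mathscr N_q=q+O(q/\log_2 q)$ with implied constant less than $1$; that is, there is a constant $c<1$ with $|\#\mathscr N_q-q|\le c\,q/\log_2 q$ for all sufficiently large $q$. (2) There is an absolute constant $C$ such that, for every function $k=k(q)$ with positive integer values and $k=o(\sqrt{\log_2 q})$ as $q\to\infty$, there is a function $\varepsilon(q)\to0$ (which may depend on the function $k$) such that for all sufficiently large $q$ (in terms of the function $k$) $$\left|I_k(\mathscr N_q)-\binom{\#\mathscr N_q}{k}\right|\le C\,(\#\mathscr N_q)^{k-3/2+\varepsilon(q)} \quad\text{and}\quad \left|I_k(\mathscr N_q)-\frac{q^k}{k!}\right|\le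 C\,\frac{q^k}{(k-1)!\,\log_2 q}.$$ -/

import Mathlib

open Filter Topology Asymptotics

noncomputable section

/-- The truncated logarithm `log x = max {ln x, 2}`. -/
def truncLog (x : ℝ) : ℝ := max (Real.log x) 2

/-- The iterated truncated logarithm `log₂ x = log (log x)`. -/
def truncLogLog (x : ℝ) : ℝ := truncLog (truncLog x)

/-- A finite set `S` of positive integers is multiplicatively independent if the only integer
exponents `α n`, `n ∈ S`, with `∏ n ∈ S, n ^ (α n) = 1` are `α n = 0` for all `n ∈ S`.
The product is taken in `ℚ`, since the exponents may be negative. -/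
def MultIndep (S : Finset ℕ) : Prop :=
  ∀ α : ℕ → ℤ, ∏ n ∈ S, (n : ℚ) ^ (α n) = 1 → ∀ n ∈ S, α n = 0

open Classical in
/-- The multiplicatively independent subsets of `A` with exactly `k` elements. -/
def multIndepSubsets (A : Finset ℕ) (k : ℕ) : Finset (Finset ℕ) :=
  (A.powersetCard k).filter MultIndep

end

/-! Take for `𝒩 q` the integers in `[2, q - 1]` that are not perfect powers and have at most `W ≈
√(log q)` distinct primes.

Few integers are lost. Perfect powers number `O(√q log q)`. Since `2 ^ ω(n) ≤ d(n)` and `d` has mean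
at most `1 + log q`, at most `q (1 + log q) / 2 ^ W` integers have more than `W` primes. Both are
far below `q / log log q`.

Few `k`-subsets are dependent. In a nontrivial relation, every prime of a term with negative
exponent divides a term with positive exponent, and conversely. If two exponents share a sign, those
two terms are built from primes of the remaining `k - 2` elements (`exists_pair_of_not_multIndep`).
Otherwise the relation reads `x ^ a = y ^ b`, impossible for distinct integers that are not perfect
powers. The remaining elements carry at most `kW` primes, so each of the two terms has at most
`(log₂ q + 1) ^ (kW)` values, with binary logarithm. For `k ≤ log log q` the square of this is at
most `(#𝒩) ^ (1/2)`, which leaves at most `(#𝒩) ^ (k - 3/2)` dependent sets.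

The second estimate follows by comparing `(#𝒩).choose k` with `q ^ k / k!`. -/

/-- `n` is a perfect power if `n = r ^ e` for some exponent `e ≥ 2`. -/
def IsPerfectPower (n : ℕ) : Prop := ∃ r e : ℕ, 2 ≤ e ∧ n = r ^ e

open Classical in
/-- The integers in `[2, q - 1]` that are not perfect powers and have at most
`√(log₂ q)` distinct prime factors (with the binary logarithm, rounded down). -/
noncomputable def fewPrimes (q : ℕ) : Finset ℕ :=
  (Finset.Icc 2 (q - 1)).filter fun n =>
    ¬ IsPerfectPower n ∧ n.primeFactors.card ≤ Nat.sqrt (Nat.log 2 q)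

/-! ### Structure of multiplicative relations -/

/-- Both numbers are powers of a common base, with exponents `b / gcd` and `a / gcd`; neither
exponent can be 2 or more. -/
theorem eq_of_pow_eq_pow_of_not_isPerfectPower {m n a b : ℕ} (hm : ¬ IsPerfectPower m)
    (hn : ¬ IsPerfectPower n) (ha : a ≠ 0) (hb : b ≠ 0) (h : m ^ a = n ^ b) : m = n := by
  obtain ⟨c, h1, h2⟩ := Nat.exists_eq_pow_of_pow_eq_pow (Or.inl ha) h
  have hga : 0 < a / Nat.gcd a b :=
    Nat.div_pos (Nat.gcd_le_left _ (Nat.pos_of_ne_zero ha)) (Nat.gcd_pos_of_pos_left _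
      (Nat.pos_of_ne_zero ha))
  have hgb : 0 < b / Nat.gcd a b :=
    Nat.div_pos (Nat.gcd_le_right _ (Nat.pos_of_ne_zero hb)) (Nat.gcd_pos_of_pos_left _
      (Nat.pos_of_ne_zero ha))
  have e1 : b / Nat.gcd a b = 1 := by
    by_contra hne
    exact hm ⟨c, _, by omega, h1⟩
  have e2 : a / Nat.gcd a b = 1 := by
    by_contra hne
    exact hn ⟨c, _, by omega, h2⟩
  erw [h1, h2, e1, e2]

theorem sum_mul_factorization_eq_zero {S : Finset ℕ} (hS : ∀ n ∈ S, n ≠ 0) {α : ℕ → ℤ}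
    (h : ∏ n ∈ S, (n : ℚ) ^ α n = 1) (p : ℕ) :
    ∑ n ∈ S, α n * (n.factorization p : ℤ) = 0 := by
  by_cases hp : p.Prime
  swap
  · simp [Nat.factorization_eq_zero_of_not_prime _ hp]
  have := Fact.mk hp
  have key : ∀ T : Finset ℕ, (∀ n ∈ T, n ≠ 0) →
      padicValRat p (∏ n ∈ T, (n : ℚ) ^ α n) = ∑ n ∈ T, α n * (n.factorization p : ℤ) := by
    intro T
    induction T using Finset.induction_on with
    | empty => simp
    | insert a T ha ih =>
      intro hT
      have ha0 : (a : ℚ) ≠ 0 := by exact_mod_cast hT a (Finset.mem_insert_self _ _)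
      rw [Finset.prod_insert ha, Finset.sum_insert ha, padicValRat.mul (zpow_ne_zero _ ha0),
        padicValRat.zpow, ih fun n hn => hT n (Finset.mem_insert_of_mem hn), padicValRat.of_nat,
        Nat.factorization_def _ hp]
      exact Finset.prod_ne_zero_iff.2 fun n hn => zpow_ne_zero _
        (by exact_mod_cast hT n (Finset.mem_insert_of_mem hn))
  rw [← key S hS, h, padicValRat.one]

/-- In a vanishing combination of factorizations, each prime of a term of negative weight divides
a term of positive weight. -/
theorem exists_pos_of_neg {S : Finset ℕ} {α : ℕ → ℤ} {p x : ℕ}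
    (h : ∑ n ∈ S, α n * (n.factorization p : ℤ) = 0) (hx : x ∈ S) (hα : α x < 0)
    (hp : p ∈ x.primeFactors) : ∃ y ∈ S, 0 < α y ∧ p ∈ y.primeFactors := by
  have hxp : 0 < x.factorization p := by
    rw [Nat.pos_iff_ne_zero, ← Finsupp.mem_support_iff, Nat.support_factorization]; exact hp
  have hneg : ∃ n ∈ S, α n * (n.factorization p : ℤ) ≠ 0 :=
    ⟨x, hx, mul_ne_zero hα.ne (by exact_mod_cast hxp.ne')⟩
  obtain ⟨y, hy, hpos⟩ := Finset.exists_pos_of_sum_zero_of_exists_nonzero _ h hneg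
  have hyp : 0 < (y.factorization p : ℤ) := by
    rcases (Nat.zero_le (y.factorization p)).eq_or_lt with h0 | h0
    · rw [← h0] at hpos; simp at hpos
    · exact_mod_cast h0
  refine ⟨y, hy, pos_of_mul_pos_left hpos hyp.le, ?_⟩
  rw [← Nat.support_factorization, Finsupp.mem_support_iff]
  exact_mod_cast hyp.ne'

/-- The witnesses from `exists_pos_of_neg` have positive weight, so they differ from both chosen
negative terms. -/
theorem exists_pair_of_two_neg {S : Finset ℕ} {α : ℕ → ℤ}
    (h : ∀ p, ∑ n ∈ S, α n * (n.factorization p : ℤ) = 0)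
    (hc : 1 < (S.filter fun n => α n < 0).card) :
    ∃ x ∈ S, ∃ y ∈ S, x ≠ y ∧
      x.primeFactors ⊆ ((S.erase x).erase y).biUnion Nat.primeFactors ∧
      y.primeFactors ⊆ ((S.erase x).erase y).biUnion Nat.primeFactors := by
  obtain ⟨x, hx, y, hy, hxy⟩ := Finset.one_lt_card.1 hc
  rw [Finset.mem_filter] at hx hy
  have key : ∀ z ∈ S, α z < 0 →
      z.primeFactors ⊆ ((S.erase x).erase y).biUnion Nat.primeFactors := by
    intro z hz hα p hp
    obtain ⟨w, hw, hw0, hwp⟩ := exists_pos_of_neg (h p) hz hα hp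
    refine Finset.mem_biUnion.2 ⟨w, ?_, hwp⟩
    refine Finset.mem_erase.2 ⟨?_, Finset.mem_erase.2 ⟨?_, hw⟩⟩
    · rintro rfl; exact absurd hy.2 (by omega)
    · rintro rfl; exact absurd hx.2 (by omega)
  exact ⟨x, hx.1, y, hy.1, hxy, key x hx.1 hx.2, key y hy.1 hy.2⟩

/-- A multiplicatively dependent set without perfect powers has two elements all of whose primes
divide the remaining elements. -/
theorem exists_pair_of_not_multIndep {S : Finset ℕ} (h2 : ∀ n ∈ S, 2 ≤ n)
    (hpp : ∀ n ∈ S, ¬ IsPerfectPower n) (hS : ¬ MultIndep S) :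
    ∃ x ∈ S, ∃ y ∈ S, x ≠ y ∧
      x.primeFactors ⊆ ((S.erase x).erase y).biUnion Nat.primeFactors ∧
      y.primeFactors ⊆ ((S.erase x).erase y).biUnion Nat.primeFactors := by
  unfold MultIndep at hS
  push Not at hS
  obtain ⟨α, hα, m, hm, hm0⟩ := hS
  have hsum := sum_mul_factorization_eq_zero (fun n hn => by have := h2 n hn; omega) hα
  have hsum' : ∀ p, ∑ n ∈ S, (-α) n * (n.factorization p : ℤ) = 0 := fun p => by
    simpa using hsum p
  by_cases hJ : 1 < (S.filter fun n => α n < 0).card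
  · exact exists_pair_of_two_neg hsum hJ
  by_cases hI : 1 < (S.filter fun n => (-α) n < 0).card
  · exact exists_pair_of_two_neg hsum' hI
  -- At most one exponent of each sign is left, and any nonzero one forces the opposite sign, so the
  -- relation reduces to `y ^ b = x ^ a`.
  exfalso
  have hprime : ∀ n ∈ S, ∃ p, p ∈ n.primeFactors := fun n hn =>
    Nat.nonempty_primeFactors.2 (by have := h2 n hn; omega)
  obtain ⟨x, hx, hx0⟩ : ∃ x ∈ S, α x < 0 := by
    rcases lt_or_gt_of_ne hm0 with h | h
    · exact ⟨m, hm, h⟩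
    · obtain ⟨p, hp⟩ := hprime m hm
      obtain ⟨x, hx, hx0, -⟩ := exists_pos_of_neg (hsum' p) hm (by simpa using h) hp
      exact ⟨x, hx, by simpa using hx0⟩
  obtain ⟨y, hy, hy0⟩ : ∃ y ∈ S, 0 < α y := by
    obtain ⟨p, hp⟩ := hprime x hx
    obtain ⟨y, hy, hy0, -⟩ := exists_pos_of_neg (hsum p) hx hx0 hp
    exact ⟨y, hy, hy0⟩
  have hxy : x ≠ y := by rintro rfl; omega
  have hrest : ∀ n ∈ S, n ≠ x ∧ n ≠ y → α n = 0 := by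
    rintro n hn ⟨hnx, hny⟩
    by_contra hn0
    rcases lt_or_gt_of_ne hn0 with h | h
    · exact hJ (Finset.one_lt_card.2 ⟨n, by simp [hn, h], x, by simp [hx, hx0], hnx⟩)
    · exact hI (Finset.one_lt_card.2 ⟨n, by simp [hn, h], y, by simp [hy, hy0], hny⟩)
  refine hxy (eq_of_pow_eq_pow_of_not_isPerfectPower (hpp x hx) (hpp y hy)
    (a := (-α x).toNat) (b := (α y).toNat) (by omega) (by omega) ?_)
  have hx2 := h2 x hx
  have hy2 := h2 y hy
  refine Nat.eq_of_factorization_eq (by positivity) (by positivity) fun p => ?_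
  have hp := hsum p
  rw [Finset.sum_eq_add_of_mem x y hx hy hxy fun n hn hne => by simp [hrest n hn hne]] at hp
  simp only [Nat.factorization_pow, Finsupp.smul_apply, smul_eq_mul]
  zify
  rw [Int.toNat_of_nonneg (by omega), Int.toNat_of_nonneg hy0.le]
  linarith

/-! ### Counting dependent subsets -/

/-- Such an integer is determined by its exponents at the primes of `P`, each at most `log₂ q`. -/
theorem card_primeFactors_subset_le {s P : Finset ℕ} {q : ℕ}
    (hs : ∀ n ∈ s, n ≠ 0 ∧ n ≤ q ∧ n.primeFactors ⊆ P) :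
    s.card ≤ (Nat.log 2 q + 1) ^ P.card := by
  have hcard : (P.pi fun _ => Finset.range (Nat.log 2 q + 1)).card =
      (Nat.log 2 q + 1) ^ P.card := by simp [Finset.card_pi]
  rw [← hcard]
  refine Finset.card_le_card_of_injOn (fun n p _ => n.factorization p) ?_ ?_
  · intro n hn
    obtain ⟨h0, hq, -⟩ := hs n hn
    refine Finset.mem_coe.2 (Finset.mem_pi.2 fun p _ => Finset.mem_range.2 (Nat.lt_succ_of_le ?_))
    by_cases hp : p.Prime
    · refine Nat.le_log_of_pow_le one_lt_two ?_
      exact (Nat.pow_le_pow_left hp.two_le _).trans ((Nat.ordProj_le p h0).trans hq)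
    · simp [Nat.factorization_eq_zero_of_not_prime _ hp]
  · intro m hm n hn hmn
    obtain ⟨hm0, -, hmP⟩ := hs m hm
    obtain ⟨hn0, -, hnP⟩ := hs n hn
    refine Nat.eq_of_factorization_eq hm0 hn0 fun p => ?_
    by_cases hp : p ∈ P
    · exact congrFun (congrFun hmn p) hp
    · rw [Finsupp.notMem_support_iff.1 fun h => hp (hmP (by simpa using h)),
        Finsupp.notMem_support_iff.1 fun h => hp (hnP (by simpa using h))]

open Classical in
theorem card_filter_not_multIndep_le {N : Finset ℕ} {q W : ℕ} (h2 : ∀ n ∈ N, 2 ≤ n)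
    (hq : ∀ n ∈ N, n ≤ q) (hpp : ∀ n ∈ N, ¬ IsPerfectPower n)
    (hW : ∀ n ∈ N, n.primeFactors.card ≤ W) (k : ℕ) :
    ((N.powersetCard k).filter fun S => ¬ MultIndep S).card ≤
      N.card ^ (k - 2) * ((Nat.log 2 q + 1) ^ (k * W)) ^ 2 := by
  set F : Finset ℕ → Finset ℕ := fun A =>
    N.filter fun n => n.primeFactors ⊆ A.biUnion Nat.primeFactors with hF
  -- A dependent set is recovered from its `k - 2` remaining elements `A` and a pair in `F A`.
  have hsub : ((N.powersetCard k).filter fun S => ¬ MultIndep S) ⊆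
      (N.powersetCard (k - 2)).biUnion fun A =>
        (F A ×ˢ F A).image fun xy => insert xy.1 (insert xy.2 A) := by
    intro S hS
    obtain ⟨hS, hdep⟩ := Finset.mem_filter.1 hS
    obtain ⟨hSN, hSk⟩ := Finset.mem_powersetCard.1 hS
    obtain ⟨x, hx, y, hy, hxy, hxP, hyP⟩ := exists_pair_of_not_multIndep
      (fun n hn => h2 n (hSN hn)) (fun n hn => hpp n (hSN hn)) hdep
    have hyx : y ∈ S.erase x := Finset.mem_erase.2 ⟨hxy.symm, hy⟩
    refine Finset.mem_biUnion.2 ⟨(S.erase x).erase y, Finset.mem_powersetCard.2 ⟨?_, ?_⟩,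
      Finset.mem_image.2 ⟨(x, y), ?_, ?_⟩⟩
    · exact (Finset.erase_subset _ _).trans ((Finset.erase_subset _ _).trans hSN)
    · rw [Finset.card_erase_of_mem hyx, Finset.card_erase_of_mem hx, hSk]; omega
    · exact Finset.mem_product.2 ⟨Finset.mem_filter.2 ⟨hSN hx, hxP⟩,
        Finset.mem_filter.2 ⟨hSN hy, hyP⟩⟩
    · simp only
      rw [Finset.insert_erase hyx, Finset.insert_erase hx]
  refine (Finset.card_le_card hsub).trans ((Finset.card_biUnion_le_card_mul _ _
    (((Nat.log 2 q + 1) ^ (k * W)) ^ 2) fun A hA => ?_).trans ?_)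
  · obtain ⟨hAN, hAk⟩ := Finset.mem_powersetCard.1 hA
    have hP : (A.biUnion Nat.primeFactors).card ≤ k * W :=
      (Finset.card_biUnion_le_card_mul _ _ W fun n hn => hW n (hAN hn)).trans
        (Nat.mul_le_mul_right _ (by omega))
    have hFA : (F A).card ≤ (Nat.log 2 q + 1) ^ (k * W) := by
      refine (card_primeFactors_subset_le (P := A.biUnion Nat.primeFactors) (q := q) ?_).trans
        (Nat.pow_le_pow_right (Nat.succ_pos _) hP)
      intro n hn
      obtain ⟨hnN, hnP⟩ := Finset.mem_filter.1 hn
      exact ⟨by have := h2 n hnN; omega, hq n hnN, hnP⟩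
    refine Finset.card_image_le.trans ?_
    rw [Finset.card_product, sq]
    exact Nat.mul_le_mul hFA hFA
  · rw [Finset.card_powersetCard]
    exact Nat.mul_le_mul_right _ (Nat.choose_le_pow _ _)

/-! ### Counting the removed integers -/

open Classical in
theorem card_isPerfectPower_le (q : ℕ) :
    ((Finset.Icc 2 (q - 1)).filter IsPerfectPower).card ≤
      (Nat.sqrt q + 1) * (Nat.log 2 q + 1) := by
  have hsub : (Finset.Icc 2 (q - 1)).filter IsPerfectPower ⊆
      (Finset.range (Nat.sqrt q + 1) ×ˢ Finset.range (Nat.log 2 q + 1)).image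
        fun re => re.1 ^ re.2 := by
    intro n hn
    obtain ⟨hn, r, e, he, rfl⟩ := Finset.mem_filter.1 hn
    obtain ⟨hn2, hnq⟩ := Finset.mem_Icc.1 hn
    have hle : r ^ e ≤ q := by omega
    have hr : 2 ≤ r := by
      by_contra hr
      have : r ^ e ≤ 1 := (Nat.pow_le_pow_left (by omega : r ≤ 1) e).trans (by simp)
      omega
    refine Finset.mem_image.2 ⟨(r, e), Finset.mem_product.2 ⟨Finset.mem_range.2 ?_,
      Finset.mem_range.2 ?_⟩, rfl⟩
    · refine Nat.lt_succ_of_le (Nat.le_sqrt.2 ?_)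
      rw [← sq]
      exact (Nat.pow_le_pow_right (by omega) he).trans hle
    · exact Nat.lt_succ_of_le (Nat.le_log_of_pow_le one_lt_two
        ((Nat.pow_le_pow_left hr e).trans hle))
  refine (Finset.card_le_card hsub).trans (Finset.card_image_le.trans ?_)
  simp

theorem two_pow_card_primeFactors_le {n : ℕ} (hn : n ≠ 0) :
    2 ^ n.primeFactors.card ≤ n.divisors.card := by
  rw [Nat.card_divisors hn, ← Finset.prod_const]
  refine Finset.prod_le_prod' fun p hp => ?_
  have : n.factorization p ≠ 0 := by
    rw [← Finsupp.mem_support_iff, Nat.support_factorization]; exact hp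
  omega

theorem sum_card_divisors_le (q : ℕ) :
    ((∑ n ∈ Finset.Ioc 0 q, n.divisors.card : ℕ) : ℝ) ≤ q * (1 + Real.log q) := by
  have h := ArithmeticFunction.sum_Ioc_sigma0_eq_sum_div q
  simp only [ArithmeticFunction.sigma_zero_apply] at h
  rw [h, Nat.cast_sum]
  calc ∑ n ∈ Finset.Ioc 0 q, ((q / n : ℕ) : ℝ) ≤ ∑ n ∈ Finset.Ioc 0 q, (q : ℝ) * (n : ℝ)⁻¹ :=
        Finset.sum_le_sum fun n _ => by rw [← div_eq_mul_inv]; exact Nat.cast_div_le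
    _ = q * ((harmonic q : ℚ) : ℝ) := by
        rw [← Finset.mul_sum, harmonic_eq_sum_Icc, Rat.cast_sum]
        simp only [Rat.cast_inv, Rat.cast_natCast]
        rfl
    _ ≤ _ := by gcongr; exact harmonic_le_one_add_log q

/-- Markov's inequality for the divisor function, which is at least `2 ^ ω(n)`. -/
theorem card_many_primeFactors_le (q W : ℕ) :
    (((Finset.Icc 2 (q - 1)).filter fun n => W < n.primeFactors.card).card : ℝ) * 2 ^ W ≤
      q * (1 + Real.log q) := by
  refine le_trans ?_ (sum_card_divisors_le q)
  norm_cast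
  rw [← smul_eq_mul]
  refine (Finset.card_nsmul_le_sum _ (fun n => n.divisors.card) _ ?_).trans
    (Finset.sum_le_sum_of_subset ?_)
  · intro n hn
    obtain ⟨hn, hW⟩ := Finset.mem_filter.1 hn
    obtain ⟨hn2, -⟩ := Finset.mem_Icc.1 hn
    exact (Nat.pow_le_pow_right two_pos hW.le).trans (two_pow_card_primeFactors_le (by omega))
  · intro n hn
    obtain ⟨hn2, hnq⟩ := Finset.mem_Icc.1 (Finset.mem_filter.1 hn).1
    exact Finset.mem_Ioc.2 ⟨by omega, by omega⟩

theorem le_card_fewPrimes_add (q : ℕ) :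
    (q : ℝ) ≤ (fewPrimes q).card + (2 + (Nat.sqrt q + 1) * (Nat.log 2 q + 1) +
      q * (1 + Real.log q) / 2 ^ Nat.sqrt (Nat.log 2 q)) := by
  classical
  set W := Nat.sqrt (Nat.log 2 q)
  have hunion : Finset.Icc 2 (q - 1) ⊆ fewPrimes q ∪
      ((Finset.Icc 2 (q - 1)).filter IsPerfectPower ∪
        (Finset.Icc 2 (q - 1)).filter fun n => W < n.primeFactors.card) := by
    intro n hn
    by_cases h1 : IsPerfectPower n
    · exact Finset.mem_union_right _ (Finset.mem_union_left _ (Finset.mem_filter.2 ⟨hn, h1⟩))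
    by_cases h2 : W < n.primeFactors.card
    · exact Finset.mem_union_right _ (Finset.mem_union_right _ (Finset.mem_filter.2 ⟨hn, h2⟩))
    · exact Finset.mem_union_left _ (Finset.mem_filter.2 ⟨hn, h1, not_lt.1 h2⟩)
  have h1 := (Finset.card_le_card hunion).trans ((Finset.card_union_le _ _).trans
    (Nat.add_le_add_left (Finset.card_union_le _ _) _))
  rw [Nat.card_Icc] at h1
  have h2 := card_isPerfectPower_le q
  have h3 : (((Finset.Icc 2 (q - 1)).filter fun n => W < n.primeFactors.card).card : ℝ) ≤
      q * (1 + Real.log q) / 2 ^ W := by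
    rw [le_div_iff₀ (by positivity)]
    exact card_many_primeFactors_le q W
  have h4 : q ≤ (fewPrimes q).card + (2 + (Nat.sqrt q + 1) * (Nat.log 2 q + 1) +
      ((Finset.Icc 2 (q - 1)).filter fun n => W < n.primeFactors.card).card) := by omega
  have h5 : (q : ℝ) ≤ (fewPrimes q).card + (2 + (Nat.sqrt q + 1) * (Nat.log 2 q + 1) +
      ((Finset.Icc 2 (q - 1)).filter fun n => W < n.primeFactors.card).card) := by
    exact_mod_cast h4
  linarith

theorem card_fewPrimes_le (q : ℕ) : (fewPrimes q).card ≤ q := by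
  classical
  refine (Finset.card_filter_le _ _).trans ?_
  rw [Nat.card_Icc]
  omega

/-! ### Inequalities for large `q` -/

/-- The real number `y` is large enough for the exponential to dominate a quartic. -/
def ExpDominates (y : ℝ) : Prop := 1 ≤ y ∧ 400 * y ^ 4 ≤ Real.exp y

theorem eventually_expDominates : ∀ᶠ y : ℝ in atTop, ExpDominates y := by
  have h := (isLittleO_iff.1 (Real.isLittleO_pow_exp_atTop (n := 4)))
    (show (0 : ℝ) < 1 / 400 by norm_num)
  filter_upwards [h, eventually_ge_atTop 1] with y hy hy1
  refine ⟨hy1, ?_⟩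
  rw [Real.norm_of_nonneg (by positivity), Real.norm_of_nonneg (Real.exp_pos _).le] at hy
  linarith

theorem ExpDominates.sq_le {y : ℝ} (h : ExpDominates y) : 400 * y ^ 2 ≤ Real.exp y := by
  refine le_trans ?_ h.2
  have := pow_le_pow_right₀ h.1 (show 2 ≤ 4 by norm_num)
  linarith

/-- The natural number `q` is large in the sense that `log q`, `√(log q)` and `log (log q)` are
all large. -/
structure IsLarge (q : ℕ) : Prop where
  -- The halves make the first and third exponentials equal to `√q` and `√(log q)`.
  log : ExpDominates (Real.log q / 2)
  sqrt : ExpDominates (√(Real.log q) / 2)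
  loglog : ExpDominates (Real.log (Real.log q) / 2)

theorem eventually_isLarge : ∀ᶠ q : ℕ in atTop, IsLarge q := by
  have h1 : Tendsto (fun q : ℕ => Real.log q) atTop atTop :=
    Real.tendsto_log_atTop.comp tendsto_natCast_atTop_atTop
  have h2 := Real.tendsto_sqrt_atTop.comp h1
  have h3 := Real.tendsto_log_atTop.comp h1
  filter_upwards [(h1.atTop_div_const two_pos).eventually eventually_expDominates,
    (h2.atTop_div_const two_pos).eventually eventually_expDominates,
    (h3.atTop_div_const two_pos).eventually eventually_expDominates] with q a b c
  exact ⟨a, b, c⟩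

namespace IsLarge

variable {q : ℕ}

theorem two_le_log (h : IsLarge q) : 2 ≤ Real.log q := by have := h.log.1; linarith

theorem two_le_loglog (h : IsLarge q) : 2 ≤ Real.log (Real.log q) := by
  have := h.loglog.1; linarith

theorem pos (h : IsLarge q) : 0 < (q : ℝ) := by
  rcases Nat.eq_zero_or_pos q with rfl | hq
  · have := h.two_le_log; norm_num at this
  · exact_mod_cast hq

theorem exp_log (h : IsLarge q) : Real.exp (Real.log q) = q := Real.exp_log h.pos

theorem truncLogLog_eq (h : IsLarge q) : truncLogLog q = Real.log (Real.log q) := by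
  rw [truncLogLog, truncLog, truncLog, max_eq_left h.two_le_log, max_eq_left h.two_le_loglog]

theorem loglog_sq_le_sqrt (h : IsLarge q) : 32 * Real.log (Real.log q) ^ 2 ≤ √(Real.log q) := by
  have h1 := h.loglog.sq_le
  have h2 : Real.exp (Real.log (Real.log q) / 2) = √(Real.log q) := by
    rw [Real.exp_half, Real.exp_log (by have := h.two_le_log; linarith)]
  rw [h2] at h1
  nlinarith [sq_nonneg (Real.log (Real.log q))]

theorem one_le_sqrt_log (h : IsLarge q) : 1 ≤ √(Real.log q) := by
  have := h.sqrt.1; linarith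

theorem sqrt_log_le_log (h : IsLarge q) : √(Real.log q) ≤ Real.log q := by
  have h1 := Real.mul_self_sqrt (show 0 ≤ Real.log q by have := h.two_le_log; linarith)
  nlinarith [h.one_le_sqrt_log]

theorem loglog_le_log (h : IsLarge q) : Real.log (Real.log q) ≤ Real.log q := by
  nlinarith [h.loglog_sq_le_sqrt, h.sqrt_log_le_log, h.two_le_loglog]

theorem log_le_self (h : IsLarge q) : 200 * Real.log q ≤ q := by
  have h1 := h.log.sq_le
  have h2 : Real.exp (Real.log q / 2) ≤ q := by
    conv_rhs => rw [← h.exp_log]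
    exact Real.exp_le_exp.2 (by have := h.two_le_log; linarith)
  nlinarith [h.two_le_log]

theorem natLog_le (h : IsLarge q) : (Nat.log 2 q : ℝ) ≤ 2 * Real.log q := by
  have hq : q ≠ 0 := by exact_mod_cast h.pos.ne'
  have h1 : ((2 : ℝ) ^ Nat.log 2 q) ≤ q := by exact_mod_cast Nat.pow_log_le_self 2 hq
  have h2 := Real.log_le_log (by positivity) h1
  rw [Real.log_pow] at h2
  have := Real.log_two_gt_d9
  have h0 : (0 : ℝ) ≤ Nat.log 2 q := Nat.cast_nonneg _
  nlinarith

theorem sqrt_natLog_le (h : IsLarge q) : (Nat.sqrt (Nat.log 2 q) : ℝ) ≤ 2 * √(Real.log q) := by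
  have h1 : ((Nat.sqrt (Nat.log 2 q) : ℝ)) ^ 2 ≤ Nat.log 2 q := by
    exact_mod_cast Nat.sqrt_le' (Nat.log 2 q)
  have h2 := h.natLog_le
  have h3 := Real.sq_sqrt (show 0 ≤ Real.log q by have := h.two_le_log; linarith)
  refine abs_le_of_sq_le_sq' ?_ (by positivity) |>.2
  nlinarith

theorem le_sqrt_natLog (h : IsLarge q) : √(Real.log q) ≤ Nat.sqrt (Nat.log 2 q) + 1 := by
  have h1 : Nat.log 2 q + 1 ≤ (Nat.sqrt (Nat.log 2 q) + 1) ^ 2 :=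
    Nat.succ_le_succ_sqrt' (Nat.log 2 q)
  have h2 : (q : ℝ) ≤ 2 ^ (Nat.log 2 q + 1) := by
    exact_mod_cast (Nat.lt_pow_succ_log_self one_lt_two q).le
  have h3 := Real.log_le_log h.pos h2
  rw [Real.log_pow] at h3
  have h4 := Real.log_two_lt_d9
  have h5 : Real.log q ≤ ((Nat.log 2 q + 1 : ℕ) : ℝ) := by
    have : (0 : ℝ) ≤ ((Nat.log 2 q + 1 : ℕ) : ℝ) := Nat.cast_nonneg _
    nlinarith
  have h6 : ((Nat.log 2 q + 1 : ℕ) : ℝ) ≤ ((Nat.sqrt (Nat.log 2 q) : ℝ) + 1) ^ 2 := by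
    exact_mod_cast h1
  exact Real.sqrt_le_iff.2 ⟨by positivity, h5.trans h6⟩

theorem log_sq_le_two_pow (h : IsLarge q) :
    8 * Real.log q * (1 + Real.log q) ≤ 2 ^ Nat.sqrt (Nat.log 2 q) := by
  have hlog := Real.log_two_gt_d9
  have h1 : Real.exp (√(Real.log q) / 2) ≤ 2 ^ (Nat.sqrt (Nat.log 2 q) + 1) := by
    have : (2 : ℝ) ^ (Nat.sqrt (Nat.log 2 q) + 1) =
        Real.exp ((Nat.sqrt (Nat.log 2 q) + 1 : ℕ) * Real.log 2) := by
      rw [Real.exp_nat_mul, Real.exp_log two_pos]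
    rw [this]
    refine Real.exp_le_exp.2 ?_
    push_cast
    nlinarith [h.le_sqrt_natLog, h.one_le_sqrt_log]
  have h2 := h.sqrt.2
  have h3 := Real.sq_sqrt (show 0 ≤ Real.log q by have := h.two_le_log; linarith)
  have h4 : 400 * (√(Real.log q) / 2) ^ 4 = 25 * Real.log q ^ 2 := by
    rw [← h3]; ring_nf; rw [h3]
  rw [pow_succ] at h1
  rw [h4] at h2
  have h5 := h2.trans h1
  nlinarith [h.two_le_log]

theorem card_removed_le (h : IsLarge q) :
    2 + ((Nat.sqrt q : ℝ) + 1) * (Nat.log 2 q + 1) +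
      q * (1 + Real.log q) / 2 ^ Nat.sqrt (Nat.log 2 q) ≤
      1 / 2 * (q / Real.log (Real.log q)) := by
  have hx := h.two_le_log
  set x := Real.log q with hxdef
  have hq := h.pos
  have ht := h.two_le_loglog
  have hE : Real.exp (x / 2) ^ 2 = q := by
    rw [← Real.exp_nat_mul, ← h.exp_log]; congr 1; push_cast; ring
  have hE0 := Real.exp_pos (x / 2)
  have hdom := h.log.sq_le
  have hs : (Nat.sqrt q : ℝ) ≤ Real.exp (x / 2) := by
    refine abs_le_of_sq_le_sq' ?_ hE0.le |>.2
    rw [hE]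
    exact_mod_cast Nat.sqrt_le' q
  -- Each of the three losses is at most `q / (8 log q)`, so the total stays below half of `q / log
  -- log q`.
  have h1 : (2 : ℝ) ≤ 1 / 8 * (q / x) := by
    rw [← mul_div_assoc, le_div_iff₀ (by linarith)]
    have := h.log_le_self
    linarith
  have h2 : ((Nat.sqrt q : ℝ) + 1) * (Nat.log 2 q + 1) ≤ 1 / 8 * (q / x) := by
    have hE1 : 1 ≤ Real.exp (x / 2) := Real.one_le_exp (by linarith)
    calc ((Nat.sqrt q : ℝ) + 1) * (Nat.log 2 q + 1)
        ≤ (2 * Real.exp (x / 2)) * (3 * x) := by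
          gcongr
          · linarith
          · have := h.natLog_le; linarith
      _ ≤ 1 / 8 * (q / x) := by
          rw [← mul_div_assoc, le_div_iff₀ (by linarith), ← hE]
          nlinarith
  have h3 : q * (1 + x) / 2 ^ Nat.sqrt (Nat.log 2 q) ≤ 1 / 8 * (q / x) := by
    rw [div_le_iff₀ (by positivity)]
    have := h.log_sq_le_two_pow
    have h4 : 1 / 8 * ((q : ℝ) / x) * (8 * x * (1 + x)) ≤
        1 / 8 * (q / x) * 2 ^ Nat.sqrt (Nat.log 2 q) := by gcongr
    refine le_trans (le_of_eq ?_) h4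
    field_simp
  have h5 : (q : ℝ) / x ≤ q / Real.log x := by
    have := h.loglog_le_log
    gcongr
  have h6 : 0 ≤ (q : ℝ) / x := by positivity
  linarith

theorem abs_card_sub_le (h : IsLarge q) :
    |((fewPrimes q).card : ℝ) - q| ≤ 1 / 2 * (q / Real.log (Real.log q)) := by
  have h1 : ((fewPrimes q).card : ℝ) ≤ q := by exact_mod_cast card_fewPrimes_le q
  have h2 := le_card_fewPrimes_add q
  have h3 := h.card_removed_le
  rw [abs_sub_comm, abs_of_nonneg (by linarith)]
  linarith

theorem half_le_card (h : IsLarge q) : (q : ℝ) / 2 ≤ (fewPrimes q).card := by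
  have h1 := (abs_le.1 h.abs_card_sub_le).1
  have h2 : (q : ℝ) / Real.log (Real.log q) ≤ q := by
    refine div_le_self h.pos.le ?_
    linarith [h.two_le_loglog]
  linarith

theorem one_le_card (h : IsLarge q) : (1 : ℝ) ≤ (fewPrimes q).card := by
  have := h.half_le_card
  have := h.log_le_self
  have := h.two_le_log
  linarith

/-- With `x = log q` and `t = log x`, the fourth power of the base expression is at most `exp (8 t k
W)`. As `k ≤ t` and `W ≤ 2√x`, the exponent is at most `16 t² √x ≤ x / 2`; the constant in
`loglog_sq_le_sqrt` is chosen for this. -/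
theorem natLog_pow_le (h : IsLarge q) {k : ℕ} (hk : (k : ℝ) ≤ Real.log (Real.log q)) :
    (((Nat.log 2 q : ℝ) + 1) ^ (k * Nat.sqrt (Nat.log 2 q))) ^ 2 ≤
      ((fewPrimes q).card : ℝ) ^ (1 / 2 : ℝ) := by
  rw [← Real.sqrt_eq_rpow]
  refine Real.le_sqrt_of_sq_le (le_trans ?_ h.half_le_card)
  set x := Real.log q with hx
  set t := Real.log x with ht
  have hx2 := h.two_le_log
  have ht2 := h.two_le_loglog
  have hbase : (Nat.log 2 q : ℝ) + 1 ≤ Real.exp (2 * t) := by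
    have h1 : Real.exp (2 * t) = x ^ 2 := by
      have := Real.exp_nat_mul t 2
      push_cast at this
      rw [this, Real.exp_log (by linarith)]
    have h2 := h.natLog_le
    have h3 : 3 ≤ x := by nlinarith [h.loglog_sq_le_sqrt, h.sqrt_log_le_log]
    rw [h1]
    nlinarith
  rw [← pow_mul, ← pow_mul]
  calc ((Nat.log 2 q : ℝ) + 1) ^ (k * Nat.sqrt (Nat.log 2 q) * (2 * 2))
      ≤ Real.exp (2 * t) ^ (k * Nat.sqrt (Nat.log 2 q) * (2 * 2)) := by gcongr
    _ = Real.exp (8 * t * (k * Nat.sqrt (Nat.log 2 q))) := by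
        rw [← Real.exp_nat_mul]; congr 1; push_cast; ring
    _ ≤ Real.exp (x / 2) := by
        refine Real.exp_le_exp.2 ?_
        have h1 := h.sqrt_natLog_le
        have h3 := Real.mul_self_sqrt (show 0 ≤ x by linarith)
        calc 8 * t * (k * (Nat.sqrt (Nat.log 2 q) : ℝ)) ≤ 8 * t * (t * (2 * √x)) := by gcongr
          _ = 32 * t ^ 2 * √x / 2 := by ring
          _ ≤ √x * √x / 2 := by gcongr; exact h.loglog_sq_le_sqrt
          _ = x / 2 := by rw [h3]
    _ ≤ q / 2 := by
        have hE : Real.exp (x / 2) ^ 2 = q := by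
          rw [← Real.exp_nat_mul, ← h.exp_log]; congr 1; push_cast; ring
        have : 2 ≤ Real.exp (x / 2) := by
          have := Real.add_one_le_exp (x / 2); linarith
        nlinarith

/-- Lets `q ^ (k - 1)` be absorbed into the error of the second estimate: the left side is at most
`exp (t² + t)` with `t = log log q`. -/
theorem factorial_mul_loglog_le (h : IsLarge q) {k : ℕ}
    (hk : (k : ℝ) ≤ Real.log (Real.log q)) :
    ((k - 1).factorial : ℝ) * Real.log (Real.log q) ≤ q := by
  set t := Real.log (Real.log q) with ht
  have ht2 := h.two_le_loglog
  have h1 : ((k - 1).factorial : ℝ) ≤ (k : ℝ) ^ k := by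
    exact_mod_cast (Nat.factorial_le (Nat.sub_le k 1)).trans (Nat.factorial_le_pow k)
  have hexp : ∀ y : ℝ, y ≤ Real.exp y := fun y => by have := Real.add_one_le_exp y; linarith
  calc ((k - 1).factorial : ℝ) * t ≤ (k : ℝ) ^ k * Real.exp t := by
        gcongr
        exact hexp t
    _ ≤ Real.exp k ^ k * Real.exp t := by gcongr; exact hexp k
    _ = Real.exp (k * k + t) := by rw [← Real.exp_nat_mul, ← Real.exp_add]
    _ ≤ Real.exp (Real.log q) := by
        refine Real.exp_le_exp.2 ?_
        have : (k : ℝ) * k ≤ t * t := by gcongr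
        nlinarith [h.loglog_sq_le_sqrt, h.sqrt_log_le_log]
    _ = q := h.exp_log

end IsLarge

/-! ### The two estimates for the number of independent subsets -/

theorem card_multIndepSubsets_le_choose (A : Finset ℕ) (k : ℕ) :
    (multIndepSubsets A k).card ≤ A.card.choose k := by
  classical
  rw [← Finset.card_powersetCard]
  exact Finset.card_filter_le _ _

theorem multIndepSubsets_one {A : Finset ℕ} (h2 : ∀ n ∈ A, 2 ≤ n) :
    multIndepSubsets A 1 = A.powersetCard 1 := by
  classical
  refine Finset.filter_true_of_mem fun S hS => ?_
  obtain ⟨hSA, hS1⟩ := Finset.mem_powersetCard.1 hS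
  obtain ⟨a, rfl⟩ := Finset.card_eq_one.1 hS1
  have ha := h2 a (hSA (Finset.mem_singleton_self a))
  intro α hα n hn
  rw [Finset.mem_singleton] at hn
  subst hn
  rw [Finset.prod_singleton] at hα
  refine (zpow_eq_one_iff_right₀ (by positivity) ?_).1 hα
  exact_mod_cast (by omega : n ≠ 1)

theorem IsLarge.abs_card_multIndepSubsets_sub_choose_le {q k : ℕ} (h : IsLarge q) (hk1 : 1 ≤ k)
    (hk : (k : ℝ) ≤ Real.log (Real.log q)) :
    |((multIndepSubsets (fewPrimes q) k).card : ℝ) - ((fewPrimes q).card.choose k : ℕ)| ≤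
      ((fewPrimes q).card : ℝ) ^ ((k : ℝ) - 3 / 2) := by
  classical
  have hmem : ∀ n ∈ fewPrimes q, (2 ≤ n ∧ n ≤ q) ∧ ¬ IsPerfectPower n ∧
      n.primeFactors.card ≤ Nat.sqrt (Nat.log 2 q) := fun n hn => by
    obtain ⟨hn, hp⟩ := Finset.mem_filter.1 hn
    obtain ⟨h2, hq⟩ := Finset.mem_Icc.1 hn
    exact ⟨⟨h2, by omega⟩, hp⟩
  -- For `k = 1` the truncated `k - 2` is 0 and the general bound is too weak for `(#𝒩) ^ (-1/2)`;
  -- singletons are handled exactly.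
  rcases hk1.eq_or_lt with rfl | hk2
  · rw [multIndepSubsets_one fun n hn => (hmem n hn).1.1, Finset.card_powersetCard, sub_self,
      abs_zero]
    positivity
  have hle : ((multIndepSubsets (fewPrimes q) k).card : ℝ) ≤ (fewPrimes q).card.choose k := by
    exact_mod_cast card_multIndepSubsets_le_choose _ _
  have hsplit : (((fewPrimes q).card.choose k : ℕ) : ℝ) = (multIndepSubsets (fewPrimes q) k).card +
      (((fewPrimes q).powersetCard k).filter fun S => ¬ MultIndep S).card := by
    rw [← Finset.card_powersetCard, ← Finset.card_filter_add_card_filter_not MultIndep]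
    push_cast
    congr!
  have hdep := card_filter_not_multIndep_le (fun n hn => (hmem n hn).1.1)
    (fun n hn => (hmem n hn).1.2) (fun n hn => (hmem n hn).2.1) (fun n hn => (hmem n hn).2.2) k
  have hdep' : ((((fewPrimes q).powersetCard k).filter fun S => ¬ MultIndep S).card : ℝ) ≤
      ((fewPrimes q).card : ℝ) ^ (k - 2) *
        (((Nat.log 2 q : ℝ) + 1) ^ (k * Nat.sqrt (Nat.log 2 q))) ^ 2 := by exact_mod_cast hdep
  have hN := h.one_le_card
  rw [abs_sub_comm, abs_of_nonneg (by linarith), hsplit, add_sub_cancel_left]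
  calc _ ≤ _ := hdep'
    _ ≤ ((fewPrimes q).card : ℝ) ^ (k - 2) * ((fewPrimes q).card : ℝ) ^ (1 / 2 : ℝ) := by
        gcongr
        exact h.natLog_pow_le hk
    _ = _ := by
        rw [← Real.rpow_natCast, ← Real.rpow_add (by linarith), Nat.cast_sub hk2]
        congr 1
        push_cast
        ring

/-- Squeeze `k! * N.choose k` between `(N + 1 - k) ^ k` and `q ^ k`. The difference of `k`-th powers
yields a factor `k`, which turns `k!` into `(k - 1)!`. -/
theorem abs_choose_sub_pow_div_factorial_le {N q k : ℕ} (hk : 1 ≤ k) (hNq : N ≤ q) :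
    |((N.choose k : ℕ) : ℝ) - (q : ℝ) ^ k / k.factorial| ≤
      (q : ℝ) ^ (k - 1) / (k - 1).factorial * (q - N + k) := by
  have hup : ((N.choose k : ℕ) : ℝ) ≤ (q : ℝ) ^ k / k.factorial :=
    (Nat.choose_le_pow_div k N).trans (by gcongr)
  have hlow : ((N + 1 - k : ℕ) : ℝ) ^ k / k.factorial ≤ (N.choose k : ℕ) := Nat.pow_le_choose k N
  set m : ℕ := N + 1 - k with hm
  have hmq : (m : ℝ) ≤ q := by exact_mod_cast (by omega : m ≤ q)
  have hmN : (N : ℝ) ≤ m + k := by exact_mod_cast (by omega : N ≤ m + k)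
  have hpow : (q : ℝ) ^ k - (m : ℝ) ^ k ≤ (q - m) * k * (q : ℝ) ^ (k - 1) := by
    have h := (le_abs_self _).trans (abs_pow_sub_pow_le (q : ℝ) (m : ℝ) k)
    rwa [abs_of_nonneg (sub_nonneg.2 hmq), Nat.abs_cast, Nat.abs_cast, max_eq_left hmq] at h
  rw [abs_sub_comm, abs_of_nonneg (by linarith)]
  have hfac : (k.factorial : ℝ) = k * (k - 1).factorial := by
    exact_mod_cast (Nat.mul_factorial_pred (by omega)).symm
  have hk0 : (0 : ℝ) < k := by exact_mod_cast hk
  calc (q : ℝ) ^ k / k.factorial - (N.choose k : ℕ)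
      ≤ (q : ℝ) ^ k / k.factorial - (m : ℝ) ^ k / k.factorial := by linarith
    _ = ((q : ℝ) ^ k - (m : ℝ) ^ k) / k.factorial := by rw [sub_div]
    _ ≤ (q - m) * k * (q : ℝ) ^ (k - 1) / k.factorial := by gcongr
    _ = (q : ℝ) ^ (k - 1) / (k - 1).factorial * (q - m) := by rw [hfac]; field_simp
    _ ≤ _ := by
        gcongr
        linarith

theorem IsLarge.abs_choose_sub_le {q k : ℕ} (h : IsLarge q) (hk1 : 1 ≤ k)
    (hk : (k : ℝ) ≤ Real.log (Real.log q)) :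
    |(((fewPrimes q).card.choose k : ℕ) : ℝ) - (q : ℝ) ^ k / k.factorial| ≤
      (q : ℝ) ^ k / ((k - 1).factorial * Real.log (Real.log q)) := by
  set t := Real.log (Real.log q) with ht
  have ht2 := h.two_le_loglog
  have hk' : (k : ℝ) ≤ 1 / 2 * (q / t) := by
    rw [← mul_div_assoc, le_div_iff₀ (by linarith)]
    have : (k : ℝ) * t ≤ t * t := by gcongr
    nlinarith [h.loglog_sq_le_sqrt, h.sqrt_log_le_log, h.log_le_self, h.two_le_log]
  have hN := (abs_le.1 h.abs_card_sub_le).1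
  calc _ ≤ _ := abs_choose_sub_pow_div_factorial_le hk1 (card_fewPrimes_le q)
    _ ≤ (q : ℝ) ^ (k - 1) / (k - 1).factorial * (q / t) := by gcongr; linarith
    _ = _ := by
        rw [div_mul_div_comm, ← pow_succ, Nat.sub_add_cancel hk1]

theorem IsLarge.abs_card_multIndepSubsets_sub_le {q k : ℕ} (h : IsLarge q) (hk1 : 1 ≤ k)
    (hk : (k : ℝ) ≤ Real.log (Real.log q)) :
    |((multIndepSubsets (fewPrimes q) k).card : ℝ) - (q : ℝ) ^ k / k.factorial| ≤
      2 * ((q : ℝ) ^ k / ((k - 1).factorial * Real.log (Real.log q))) := by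
  have h1 := h.abs_card_multIndepSubsets_sub_choose_le hk1 hk
  have h2 := h.abs_choose_sub_le hk1 hk
  have ht2 := h.two_le_loglog
  have hN : ((fewPrimes q).card : ℝ) ≤ q := by exact_mod_cast card_fewPrimes_le q
  have hN1 := h.one_le_card
  have h3 : ((fewPrimes q).card : ℝ) ^ ((k : ℝ) - 3 / 2) ≤
      (q : ℝ) ^ k / ((k - 1).factorial * Real.log (Real.log q)) := by
    calc ((fewPrimes q).card : ℝ) ^ ((k : ℝ) - 3 / 2)
        ≤ ((fewPrimes q).card : ℝ) ^ ((k : ℝ) - 1) := 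
          Real.rpow_le_rpow_of_exponent_le hN1 (by linarith)
      _ = ((fewPrimes q).card : ℝ) ^ (k - 1) := by
          rw [← Real.rpow_natCast, Nat.cast_sub hk1, Nat.cast_one]
      _ ≤ (q : ℝ) ^ (k - 1) := by gcongr
      _ = (q : ℝ) ^ k / q := by
          rw [eq_div_iff h.pos.ne', ← pow_succ, Nat.sub_add_cancel hk1]
      _ ≤ _ := by
          gcongr
          exact h.factorial_mul_loglog_le hk
  refine (abs_sub_le _ (((fewPrimes q).card.choose k : ℕ) : ℝ) _).trans ?_
  linarith

theorem theorem3p1 :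
    ∃ 𝒩 : ℕ → Finset ℕ,
      (∀ q : ℕ, 𝒩 q ⊆ Finset.Icc 2 (q - 1)) ∧
      (∃ c : ℝ, c < 1 ∧ ∀ᶠ q : ℕ in atTop,
        |((𝒩 q).card : ℝ) - (q : ℝ)| ≤ c * ((q : ℝ) / truncLogLog q)) ∧
      ∃ C : ℝ, ∀ k : ℕ → ℕ, (∀ q : ℕ, 1 ≤ k q) →
        (fun q : ℕ => (k q : ℝ)) =o[atTop] (fun q : ℕ => √(truncLogLog q)) →
        (∃ ε : ℕ → ℝ, Tendsto ε atTop (𝓝 0) ∧ ∀ᶠ q : ℕ in atTop,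
          |((multIndepSubsets (𝒩 q) (k q)).card : ℝ) - (((𝒩 q).card.choose (k q) : ℕ) : ℝ)| ≤
            C * ((𝒩 q).card : ℝ) ^ ((k q : ℝ) - 3 / 2 + ε q)) ∧
        ∀ᶠ q : ℕ in atTop,
          |((multIndepSubsets (𝒩 q) (k q)).card : ℝ) -
              (q : ℝ) ^ (k q) / ((k q).factorial : ℝ)| ≤
            C * ((q : ℝ) ^ (k q) / (((k q - 1).factorial : ℝ) * truncLogLog q)) := by
  classical
  refine ⟨fewPrimes, fun q => Finset.filter_subset _ _, ⟨1 / 2, by norm_num, ?_⟩, 2, ?_⟩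
  · filter_upwards [eventually_isLarge] with q hq
    rw [hq.truncLogLog_eq]
    exact hq.abs_card_sub_le
  intro k hk1 hko
  have hk : ∀ᶠ q : ℕ in atTop, IsLarge q ∧ (k q : ℝ) ≤ Real.log (Real.log q) := by
    filter_upwards [eventually_isLarge, hko.bound one_pos] with q hq hkq
    refine ⟨hq, ?_⟩
    rw [hq.truncLogLog_eq, one_mul, Real.norm_of_nonneg (Nat.cast_nonneg _),
      Real.norm_of_nonneg (Real.sqrt_nonneg _)] at hkq
    have ht := hq.two_le_loglog
    refine hkq.trans (Real.sqrt_le_iff.2 ⟨by linarith, ?_⟩)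
    nlinarith
  -- The count of dependent sets already meets the exponent `k - 3/2`, so `ε = 0` works.
  refine ⟨⟨fun _ => 0, tendsto_const_nhds, ?_⟩, ?_⟩
  · filter_upwards [hk] with q ⟨hq, hkq⟩
    rw [add_zero]
    refine (hq.abs_card_multIndepSubsets_sub_choose_le (hk1 q) hkq).trans ?_
    exact le_mul_of_one_le_left (by positivity) one_le_two
  · filter_upwards [hk] with q ⟨hq, hkq⟩
    rw [hq.truncLogLog_eq]
    exact hq.abs_card_multIndepSubsets_sub_le (hk1 q) hkq
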